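/- Conventions. All rings are commutative with $1$. For a finitely generated module $M$ over a Noetherian ring $R$, $\dim_R M$ is the Krull dimension of $\operatorname{Supp}_R M$ (equal to $-\infty$ if $M=0$). For an ideal $I$ of $R$, $\operatorname{grade}(I,M)$ is the supremum of the lengths of the $M$-regular sequences contained in $I$ if $IM\neq M$, and $\infty$ if $IM=M$. If $I$ is a proper ideal, $M$ is called $I$-Cohen Macaulay if $\operatorname{grade}(I,M)+\dim_R(M/IM)=\dim_R M$. Statement. Let $f:R\to S$ be a homomorphism of Noetherian rings and $I$ a proper ideal of $R$. Let $M$ be a finitely generated $R$-module and $N$ a finitely generated $S$-module that is flat over $R$ (via $f$). Let $\mathfrak q\in\operatorname{Spec} S$ and $\mathfrak p=\mathfrak q\cap R=f^{-1}(\mathfrak q)$, and suppose that $I\subseteq\mathfrak p$ and that $(M\otimes_R N)_{\mathfrak q}\neq I(M\otimes_R N)_{\mathfrak q}$, where $(M\otimes_R N)_{\mathfrak q}$ is the localization at $\mathfrak q$ of the $S$-module $M\otimes_R N$. Then the following conditions are equivalent: (1) $M_{\mathfrak p}$ is $IR_{\mathfrak p}$-Cohen Macaulay and $\dim_{S_{\mathfrak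 q}}\dfrac{(M\otimes_R N)_{\mathfrak q}}{\mathfrak p(M\otimes_R N)_{\mathfrak q}}=0$. (2) $(M\otimes_R N)_{\mathfrak q}$ is $IS_{\mathfrak q}$-Cohen Macaulay, $\operatorname{grade}(IR_{\mathfrak p},M_{\mathfrak p})=\operatorname{grade}(IS_{\mathfrak q},(M\otimes_R N)_{\mathfrak q})$ and $\dim_{R_{\mathfrak p}}M_{\mathfrak p}/IM_{\mathfrak p}=\dim_{S_{\mathfrak q}}\dfrac{(M\otimes_R N)_{\mathfrak q}}{IS_{\mathfrak q}(M\otimes_R N)_{\mathfrak q}}$. (3) $(M\otimes_R N)_{\mathfrak q}$ is $IS_{\mathfrak q}$-Cohen Macaulay, $\operatorname{grade}(IR_{\mathfrak p},M_{\mathfrak p})=\operatorname{grade}(IS_{\mathfrak q},(M\otimes_R N)_{\mathfrak q})$ and $\dim_{R_{\mathfrak p}}M_{\mathfrak p}=\dim_{S_{\mathfrak q}}(M\otimes_R N)_{\mathfrak q}$. -/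

import Mathlib

open scoped TensorProduct

noncomputable section

open Classical in
/-- The grade of an ideal `I` on a module `M` (meant for `M` finitely generated over a Noetherian
ring): the supremum of the lengths of the `M`-regular sequences contained in `I` if `IM ≠ M`,
and `∞` if `IM = M`. -/
def Ideal.gradeOn {R : Type*} [CommRing R] (I : Ideal R)
    (M : Type*) [AddCommGroup M] [Module R M] : ℕ∞ :=
  if (I • ⊤ : Submodule R M) = ⊤ then ⊤
  else ⨆ rs ∈ {rs : List R | (∀ r ∈ rs, r ∈ I) ∧ RingTheory.Sequence.IsRegular M rs},
    (rs.length : ℕ∞)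

/-- For a proper ideal `I`, the module `M` is `I`-Cohen Macaulay if
`grade(I, M) + dim (M / IM) = dim M`. The dimension is the Krull dimension of the support,
with values in `WithBot ℕ∞`. -/
def Ideal.IsCohenMacaulayOn {R : Type*} [CommRing R] (I : Ideal R)
    (M : Type*) [AddCommGroup M] [Module R M] : Prop :=
  (I.gradeOn M : WithBot ℕ∞) + Module.supportDim R (M ⧸ (I • ⊤ : Submodule R M)) =
    Module.supportDim R M

/-- The extension of an ideal of `R` to the local ring `S_q`, along `R → S → S_q`. -/
abbrev Ideal.extendAtPrime {R S : Type*} [CommRing R] [CommRing S] [Algebra R S]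
    (q : Ideal S) [q.IsPrime] (I : Ideal R) : Ideal (Localization.AtPrime q) :=
  (I.map (algebraMap R S)).map (algebraMap S (Localization.AtPrime q))

end

/-! ### Quotients of a tensor product by an extended ideal. -/

section TensorQuotient

variable {A B : Type*} [CommRing A] [CommRing B] [Algebra A B]
  (N : Type*) [AddCommGroup N] [Module A N] [Module B N] [IsScalarTower A B N]
  (M : Type*) [AddCommGroup M] [Module A M]

/-! After localizing, `A → B` is a local homomorphism of Noetherian local rings, `N` is finite over
`B` and flat over `A`, and `X = N ⊗ M` is nonzero. Two facts carry the theorem. Grade is invariant: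
`grade(JB, X) = grade(J, M)` (`Ideal.gradeOn_tensorProduct`). Flatness carries regular sequences
from `M` to `X`; conversely, regular elements of `JB` on `X` are exchanged one at a time for
elements of `J` regular on `M`. Dimension is additive: `dim X = dim M + f`, where `f = dim X / 𝔪_A
X` (`Module.supportDim_tensorProduct`), by going-down between the supports. Applied to `M / JM` it
gives `dim X / JX = dim M / JM + f` with the same `f`, since `J ⊆ 𝔪_A`. So the grade equalities hold
automatically, each dimension equality says `f = 0`, and when `f = 0` the two Cohen Macaulay
equations coincide. -/

theorem TensorProduct.AlgebraTensorModule.range_lTensor_smul_top (J : Ideal A) :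
    LinearMap.range (TensorProduct.AlgebraTensorModule.lTensor B N
      ((J • ⊤ : Submodule A M).subtype)) =
      (J.map (algebraMap A B) • ⊤ : Submodule B (N ⊗[A] M)) := by
  apply le_antisymm
  · rintro _ ⟨t, rfl⟩
    induction t with
    | zero => simp
    | add x y hx hy => rw [map_add]; exact add_mem hx hy
    | tmul n y =>
      obtain ⟨y, hy⟩ := y
      change n ⊗ₜ[A] y ∈ _
      induction hy using Submodule.smul_induction_on' with
      | smul r hr m _ =>
        rw [TensorProduct.tmul_smul, ← algebraMap_smul B r]
        exact Submodule.smul_mem_smul (Ideal.mem_map_of_mem _ hr) trivial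
      | add x _ y _ hx hy => rw [TensorProduct.tmul_add]; exact add_mem hx hy
  · rw [Submodule.smul_le]
    intro r hr t _
    induction hr using Submodule.span_induction generalizing t with
    | zero => simp
    | add x y _ _ hx hy => rw [add_smul]; exact add_mem (hx t trivial) (hy t trivial)
    | smul a x _ hx => rw [smul_assoc]; exact Submodule.smul_mem _ _ (hx t trivial)
    | mem x hx =>
      obtain ⟨r, hr, rfl⟩ := hx
      induction t with
      | zero => simp
      | add x y hx hy => rw [smul_add]; exact add_mem (hx trivial) (hy trivial)
      | tmul n m =>
        rw [algebraMap_smul, ← TensorProduct.tmul_smul]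
        exact ⟨n ⊗ₜ ⟨r • m, Submodule.smul_mem_smul hr trivial⟩, rfl⟩

/-- `N ⊗ (M / JM) ≃ (N ⊗ M) / J(N ⊗ M)`, linearly over the algebra that acts on `N`. -/
noncomputable def TensorProduct.AlgebraTensorModule.tensorQuotSMulTopEquiv (J : Ideal A) :
    N ⊗[A] (M ⧸ (J • ⊤ : Submodule A M)) ≃ₗ[B]
      (N ⊗[A] M) ⧸ (J.map (algebraMap A B) • ⊤ : Submodule B (N ⊗[A] M)) :=
  TensorProduct.AlgebraTensorModule.tensorQuotientEquiv B A N (J • ⊤ : Submodule A M) ≪≫ₗ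
    Submodule.quotEquivOfEq _ _
      (TensorProduct.AlgebraTensorModule.range_lTensor_smul_top N M J)

open Pointwise in
/-- `N ⊗ (M / aM) ≃ (N ⊗ M) / a(N ⊗ M)`, linearly over the algebra that acts on `N`. -/
noncomputable def TensorProduct.AlgebraTensorModule.tensorQuotSMulTopElementEquiv (a : A) :
    N ⊗[A] QuotSMulTop a M ≃ₗ[B] QuotSMulTop (algebraMap A B a) (N ⊗[A] M) :=
  TensorProduct.AlgebraTensorModule.congr (.refl B N)
      (Submodule.quotEquivOfEq _ _ (Submodule.ideal_span_singleton_smul a ⊤).symm) ≪≫ₗ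
    TensorProduct.AlgebraTensorModule.tensorQuotSMulTopEquiv N M (Ideal.span {a}) ≪≫ₗ
      Submodule.quotEquivOfEq _ _ (by
        rw [Ideal.map_span, Set.image_singleton, Submodule.ideal_span_singleton_smul])

end TensorQuotient

/-! ### Exchanging the first element of a regular sequence, by vanishing of Ext. -/

section Exchange

open IsLocalRing RingTheory.Sequence CategoryTheory Abelian

universe u v

theorem IsLocalRing.ideal_smul_top_lt_top {R M : Type*} [CommRing R] [IsLocalRing R]
    [AddCommGroup M] [Module R M] [Module.Finite R M] [Nontrivial M] {J : Ideal R}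
    (hJ : J ≤ maximalIdeal R) : J • (⊤ : Submodule R M) < ⊤ :=
  (Submodule.top_ne_ideal_smul_of_le_jacobson_annihilator
    (hJ.trans (maximalIdeal_le_jacobson _))).symm.lt_top

variable {R : Type u} [CommRing R] [IsNoetherianRing R] [IsLocalRing R]

/-- A regular sequence of length `n + 1` in `J` forces `Ext^i(R/J, M) = 0` for `i ≤ n`. The long
exact sequence of `0 → M → M → M/aM → 0` then kills `Ext^i(R/J, M/aM)` for `i < n`, and this
vanishing yields a regular sequence of length `n`. -/
theorem ModuleCat.exists_isRegular_quotSMulTop [Small.{v} R] {J : Ideal R}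
    (hJ : J ≤ maximalIdeal R) (M : ModuleCat.{v} R) [Module.Finite R M] {n : ℕ} {rs : List R}
    (hlen : rs.length = n + 1) (hmem : ∀ r ∈ rs, r ∈ J) (hrs : IsRegular M rs)
    {a : R} (ha : a ∈ J) (hreg : IsSMulRegular M a) :
    ∃ rs' : List R, rs'.length = n ∧ (∀ r ∈ rs', r ∈ J) ∧ IsRegular (QuotSMulTop a M) rs' := by
  have : Nontrivial M := hrs.nontrivial
  have : Nontrivial (QuotSMulTop a M) := nontrivial_quotSMulTop_of_mem_maximalIdeal M (hJ ha)
  let Q := ModuleCat.of R (Shrink.{v} (R ⧸ J))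
  have hQ : Module.support R Q = PrimeSpectrum.zeroLocus J := by
    rw [(Shrink.linearEquiv R (R ⧸ J)).support_eq, Module.support_eq_zeroLocus,
      Ideal.annihilator_quotient]
  have : Module.Finite R Q := Module.Finite.equiv (Shrink.linearEquiv R (R ⧸ J)).symm
  have hExt := ModuleCat.subsingleton_ext_of_exists_isRegular J Q hQ.subset M
    (ideal_smul_top_lt_top hJ) rs hmem hrs
  refine ModuleCat.exists_isRegular_of_exists_subsingleton_ext J n
    (ModuleCat.of R (QuotSMulTop a M)) (ideal_smul_top_lt_top hJ) Q hQ fun i hi ↦ ?_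
  have h1 := AddCommGrpCat.isZero_of_iff_subsingleton.mpr (hExt i (by lia))
  have h2 := AddCommGrpCat.isZero_of_iff_subsingleton.mpr (hExt (i + 1) (by lia))
  exact AddCommGrpCat.subsingleton_of_isZero <| ShortComplex.Exact.isZero_of_both_zeros
    ((Ext.covariant_sequence_exact₃' Q hreg.smulShortComplex_shortExact) i (i + 1) rfl)
    (h1.eq_zero_of_src _) (h2.eq_zero_of_tgt _)

/-- If an ideal of a local ring contains an `M`-regular sequence of length `n + 1`, then for
every `M`-regular element `a` of the ideal it contains an `M / aM`-regular sequence of length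
`n`. -/
theorem RingTheory.Sequence.IsRegular.exists_quotSMulTop {M : Type v} [AddCommGroup M]
    [Module R M] [Module.Finite R M] {J : Ideal R} (hJ : J ≤ maximalIdeal R) {n : ℕ}
    {rs : List R} (hlen : rs.length = n + 1) (hmem : ∀ r ∈ rs, r ∈ J) (hrs : IsRegular M rs)
    {a : R} (ha : a ∈ J) (hreg : IsSMulRegular M a) :
    ∃ rs' : List R, rs'.length = n ∧ (∀ r ∈ rs', r ∈ J) ∧ IsRegular (QuotSMulTop a M) rs' := by
  -- Lifting `M` to a universe that contains that of `R` supplies the smallness needed for Ext.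
  let e : ULift.{u} M ≃ₗ[R] M := ULift.moduleEquiv
  obtain ⟨rs', h1, h2, h3⟩ := ModuleCat.exists_isRegular_quotSMulTop hJ
    (ModuleCat.of R (ULift.{u} M)) hlen hmem ((e.isRegular_congr rs).mpr hrs) ha
    ((e.isSMulRegular_congr a).mpr hreg)
  exact ⟨rs', h1, h2, ((QuotSMulTop.congr a e).isRegular_congr rs').mp h3⟩

end Exchange

instance TensorProduct.AlgebraTensorModule.finite {A B : Type*} [CommRing A] [CommRing B]
    [Algebra A B] (N : Type*) [AddCommGroup N] [Module A N] [Module B N] [IsScalarTower A B N]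
    [Module.Finite B N] (M : Type*) [AddCommGroup M] [Module A M] [Module.Finite A M] :
    Module.Finite B (N ⊗[A] M) :=
  Module.Finite.equiv (TensorProduct.AlgebraTensorModule.cancelBaseChange A B B N M)

/-! ### Invariance of grade under a flat local base. -/

section LocalGrade

open IsLocalRing RingTheory.Sequence

variable {A B : Type*} [CommRing A] [IsLocalRing A]
  [CommRing B] [IsLocalRing B] [Algebra A B] [IsLocalHom (algebraMap A B)]

theorem IsLocalRing.map_algebraMap_le_maximalIdeal {J : Ideal A} (hJ : J ≤ maximalIdeal A) :
    J.map (algebraMap A B) ≤ maximalIdeal B :=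
  (Ideal.map_mono hJ).trans (((local_hom_TFAE (algebraMap A B)).out 0 2).mp ‹_›)

/-- Nakayama is applied over `B`, where `N` is finite: `𝔪_A N ⊆ 𝔪_B N ≠ N`. -/
theorem Module.FaithfullyFlat.of_isLocalHom (A B N : Type*) [CommRing A] [IsLocalRing A]
    [CommRing B] [IsLocalRing B] [Algebra A B] [IsLocalHom (algebraMap A B)]
    [AddCommGroup N] [Module A N] [Module B N] [IsScalarTower A B N] [Module.Finite B N]
    [Module.Flat A N] [Nontrivial N] : Module.FaithfullyFlat A N where
  submodule_ne_top m hm h := by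
    obtain rfl := IsLocalRing.eq_maximalIdeal hm
    have h' : (maximalIdeal A).map (algebraMap A B) • (⊤ : Submodule B N) = ⊤ := by
      rw [← Submodule.restrictScalars_inj A, Ideal.smul_restrictScalars,
        Submodule.restrictScalars_top, h]
    exact (ideal_smul_top_lt_top (map_algebraMap_le_maximalIdeal le_rfl)).ne h'

variable {N : Type*} [AddCommGroup N] [Module A N] [Module B N] [IsScalarTower A B N]
  [Module.Finite B N] [Module.Flat A N]

/-- If `J` had no `M`-regular element, then `Hom(A/J, M) ≠ 0`, and the image `L` of a nonzero map is
killed by `J`. By faithful flatness `N ⊗ L` is a nonzero submodule of `N ⊗ M`, and `b ∈ JB` kills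
it. -/
theorem IsSMulRegular.exists_mem_isSMulRegular_of_tensorProduct [IsNoetherianRing A]
    {M : Type*} [AddCommGroup M] [Module A M] [Module.Finite A M]
    [Nontrivial N] {J : Ideal A} {b : B} (hb : b ∈ J.map (algebraMap A B))
    (hreg : IsSMulRegular (N ⊗[A] M) b) : ∃ a ∈ J, IsSMulRegular M a := by
  have := Module.FaithfullyFlat.of_isLocalHom A B N
  by_contra! h
  have hnot : ¬ Subsingleton ((A ⧸ J) →ₗ[A] M) := by
    rw [IsSMulRegular.subsingleton_linearMap_iff, Ideal.annihilator_quotient]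
    simpa using h
  rw [not_subsingleton_iff_nontrivial] at hnot
  obtain ⟨f, hf⟩ := exists_ne (0 : (A ⧸ J) →ₗ[A] M)
  let L := LinearMap.range f
  have hL : Nontrivial L := by
    rw [Submodule.nontrivial_iff_ne_bot, Ne, LinearMap.range_eq_bot]
    exact hf
  have hkill : ∀ a ∈ J, ∀ y : L, a • y = 0 := by
    rintro a ha ⟨_, x, rfl⟩
    ext
    change a • f x = 0
    rw [← map_smul, Module.mem_annihilator.mp
      ((Ideal.annihilator_quotient (I := J)).symm ▸ ha), map_zero]
  obtain ⟨t, ht⟩ := @exists_ne _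
    ((Module.FaithfullyFlat.nontrivial_tensorProduct_iff_right A N (N := L)).mpr hL) 0
  have hJ : J.map (algebraMap A B) ≤ Module.annihilator B (N ⊗[A] L) := by
    rw [Ideal.map_le_iff_le_comap]
    intro a ha
    rw [Ideal.mem_comap, Module.mem_annihilator]
    intro t
    rw [algebraMap_smul]
    induction t with
    | zero => simp
    | add x y hx hy => rw [smul_add, hx, hy, add_zero]
    | tmul n y => rw [← TensorProduct.tmul_smul, hkill a ha, TensorProduct.tmul_zero]
  have hbt := Module.mem_annihilator.mp (hJ hb) t
  let g := TensorProduct.AlgebraTensorModule.lTensor B N L.subtype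
  have hg : Function.Injective g :=
    Module.Flat.lTensor_preserves_injective_linearMap (M := N) L.subtype L.injective_subtype
  have h0 : b • g t = b • 0 := by rw [← map_smul, hbt, map_zero, smul_zero]
  exact ht (hg ((hreg h0).trans (map_zero g).symm))

variable [IsNoetherianRing A] [IsNoetherianRing B]

theorem RingTheory.Sequence.IsRegular.exists_of_tensorProduct {M : Type*} [AddCommGroup M]
    [Module A M] [Module.Finite A M] {J : Ideal A} (hJ : J ≤ maximalIdeal A) {rs : List B}
    (hmem : ∀ r ∈ rs, r ∈ J.map (algebraMap A B)) (hrs : IsRegular (N ⊗[A] M) rs) :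
    ∃ rs' : List A, rs'.length = rs.length ∧ (∀ r ∈ rs', r ∈ J) ∧ IsRegular M rs' := by
  generalize hn : rs.length = n
  have : Nontrivial N := by
    by_contra! h
    have := hrs.nontrivial
    exact not_subsingleton (N ⊗[A] M) inferInstance
  induction n generalizing M rs with
  | zero =>
    have : Nontrivial (N ⊗[A] M) := hrs.nontrivial
    have : Nontrivial M := by
      by_contra! h
      exact not_subsingleton (N ⊗[A] M) inferInstance
    exact ⟨[], rfl, by simp, .nil A M⟩
  | succ n ih =>
    match rs with
    | [] => simp at hn
    | b :: bs =>
      have hb : b ∈ J.map (algebraMap A B) := hmem b (by simp)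
      obtain ⟨a, ha, hreg⟩ := IsSMulRegular.exists_mem_isSMulRegular_of_tensorProduct
        hb ((isRegular_cons_iff _ _ _).mp hrs).1
      have hreg' : IsSMulRegular (N ⊗[A] M) (algebraMap A B a) := fun x y hxy ↦
        hreg.lTensor N (by simpa only [algebraMap_smul] using hxy)
      -- The element `a` replaces `b` as first term; the rest of the sequence is then regular on `N
      -- ⊗ (M/aM)`, to which the induction hypothesis applies.
      obtain ⟨cs, hlen, hcs, hcreg⟩ := hrs.exists_quotSMulTop
        (map_algebraMap_le_maximalIdeal hJ) hn hmem (Ideal.mem_map_of_mem _ ha) hreg'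
      have hcreg' := ((TensorProduct.AlgebraTensorModule.tensorQuotSMulTopElementEquiv N M
        a).isRegular_congr cs).mpr hcreg
      obtain ⟨as, h1, h2, h3⟩ := ih hcs hcreg' hlen
      exact ⟨a :: as, by simp [h1], by simpa [ha] using h2, (isRegular_cons_iff M a as).mpr ⟨hreg, h3⟩⟩

variable (B N) in
theorem Ideal.gradeOn_tensorProduct (M : Type*) [AddCommGroup M] [Module A M]
    [Module.Finite A M] [Nontrivial (N ⊗[A] M)] {J : Ideal A} (hJ : J ≤ maximalIdeal A) :
    (J.map (algebraMap A B)).gradeOn (N ⊗[A] M) = J.gradeOn M := by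
  have : Nontrivial M := by
    by_contra! h
    exact not_subsingleton (N ⊗[A] M) inferInstance
  have hJ' := map_algebraMap_le_maximalIdeal (B := B) hJ
  rw [Ideal.gradeOn, Ideal.gradeOn, if_neg (ideal_smul_top_lt_top hJ').ne,
    if_neg (ideal_smul_top_lt_top hJ).ne]
  apply le_antisymm
  · refine iSup₂_le fun rs hrs ↦ ?_
    obtain ⟨rs', hlen, h1, h2⟩ := hrs.2.exists_of_tensorProduct hJ hrs.1
    rw [← hlen]
    exact le_iSup₂_of_le rs' ⟨h1, h2⟩ le_rfl
  · refine iSup₂_le fun rs hrs ↦ ?_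
    have hmem : ∀ r ∈ rs.map (algebraMap A B), r ∈ J.map (algebraMap A B) := by
      intro r hr
      obtain ⟨a, ha, rfl⟩ := List.mem_map.mp hr
      exact Ideal.mem_map_of_mem _ (hrs.1 a ha)
    refine le_iSup₂_of_le (rs.map (algebraMap A B)) ⟨hmem, ?_⟩ (by simp)
    refine .of_isWeaklyRegular_of_mem_maximalIdeal _ (fun r hr ↦ hJ' (hmem r hr)) ?_
    rw [isWeaklyRegular_map_algebraMap_iff]
    exact hrs.2.toIsWeaklyRegular.isWeaklyRegular_lTensor

end LocalGrade

/-! ### Supports of tensor products and lifting of primes. -/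

section Support

variable {A B : Type*} [CommRing A] [CommRing B] [Algebra A B]
  {N : Type*} [AddCommGroup N] [Module A N] [Module B N] [IsScalarTower A B N]
  {M : Type*} [AddCommGroup M] [Module A M]

variable (B N M) in
theorem Module.annihilator_le_comap_annihilator_tensorProduct :
    Module.annihilator A M ≤ (Module.annihilator B (N ⊗[A] M)).comap (algebraMap A B) := by
  intro a ha
  rw [Ideal.mem_comap, Module.mem_annihilator]
  intro t
  rw [algebraMap_smul]
  induction t with
  | zero => simp
  | add x y hx hy => rw [smul_add, hx, hy, add_zero]
  | tmul n y =>
    rw [← TensorProduct.tmul_smul, Module.mem_annihilator.mp ha, TensorProduct.tmul_zero]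

variable (B N M) in
theorem Module.annihilator_le_annihilator_tensorProduct :
    Module.annihilator B N ≤ Module.annihilator B (N ⊗[A] M) := by
  intro b hb
  rw [Module.mem_annihilator]
  intro t
  induction t with
  | zero => simp
  | add x y hx hy => rw [smul_add, hx, hy, add_zero]
  | tmul n y =>
    rw [TensorProduct.smul_tmul', Module.mem_annihilator.mp hb, TensorProduct.zero_tmul]

/-- For some `m`, `Ann(m) ⊆ p`; then `A/Ann(m)` embeds in `M` and surjects onto `A/p`, and tensoring
with the flat `N` preserves both maps. -/
theorem Module.support_tensorProduct_quotient_subset [Module.Flat A N] {p : PrimeSpectrum A}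
    (hp : p ∈ Module.support A M) :
    Module.support B (N ⊗[A] (A ⧸ p.asIdeal)) ⊆ Module.support B (N ⊗[A] M) := by
  obtain ⟨m, hm⟩ := Module.mem_support_iff_exists_annihilator.mp hp
  let φ := LinearMap.toSpanSingleton A M m
  have hφ : LinearMap.ker φ ≤ p.asIdeal := by
    intro a ha
    exact hm (by simpa [Submodule.mem_annihilator_span_singleton, φ] using ha)
  let i : (A ⧸ LinearMap.ker φ) →ₗ[A] M := (LinearMap.ker φ).liftQ φ le_rfl
  have hi : Function.Injective i := LinearMap.ker_eq_bot.mp (Submodule.ker_liftQ_eq_bot' _ _ rfl)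
  let s : (A ⧸ LinearMap.ker φ) →ₗ[A] (A ⧸ p.asIdeal) := Submodule.factor hφ
  have hs : Function.Surjective s := Submodule.factor_surjective hφ
  exact (Module.support_subset_of_surjective (TensorProduct.AlgebraTensorModule.lTensor B N s)
      (LinearMap.lTensor_surjective N hs)).trans
    (Module.support_subset_of_injective (TensorProduct.AlgebraTensorModule.lTensor B N i)
      (Module.Flat.lTensor_preserves_injective_linearMap i hi))

theorem Module.mem_support_tensorProduct_quotient [Module.Finite B N] {p : Ideal A}
    {q : PrimeSpectrum B} (hq : q ∈ Module.support B N)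
    (hpq : p ≤ q.asIdeal.comap (algebraMap A B)) :
    q ∈ Module.support B (N ⊗[A] (A ⧸ p)) := by
  have e : N ⊗[A] (A ⧸ p) ≃ₗ[B] (N ⊗[A] A) ⧸ (p.map (algebraMap A B) • ⊤ : Submodule B (N ⊗[A] A)) :=
    TensorProduct.AlgebraTensorModule.congr (.refl B N)
      (Submodule.quotEquivOfEq _ _ (by simp)) ≪≫ₗ
    TensorProduct.AlgebraTensorModule.tensorQuotSMulTopEquiv N A p
  rw [e.support_eq, Module.support_quotient,
    (TensorProduct.AlgebraTensorModule.rid A B N).support_eq]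
  exact ⟨hq, Ideal.map_le_iff_le_comap.mpr hpq⟩

/-- This is going-down inside the supports. Take `Q' ⊆ Q` minimal over the annihilator of `N ⊗ A/p`.
It is an associated prime, so it consists of zero divisors, whereas by flatness every element of `A`
outside `p` is regular on `N ⊗ A/p`. Hence `Q'` contracts to `p`. -/
theorem Module.exists_le_comap_eq_of_flat [IsNoetherianRing B] [Module.Finite B N]
    [Module.Flat A N] [Module.Finite A M] {p : Ideal A} [p.IsPrime]
    (hp : Module.annihilator A M ≤ p) {Q : Ideal B} [Q.IsPrime]
    (hQ : Module.annihilator B (N ⊗[A] M) ≤ Q) (hpQ : p ≤ Q.comap (algebraMap A B)) :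
    ∃ Q' ≤ Q, Q'.IsPrime ∧ Q'.comap (algebraMap A B) = p ∧
      Module.annihilator B (N ⊗[A] M) ≤ Q' := by
  have hQY : Module.annihilator B (N ⊗[A] (A ⧸ p)) ≤ Q :=
    Module.mem_support_iff_of_finite.mp (Module.mem_support_tensorProduct_quotient (q := ⟨Q, ‹_›⟩)
      (Module.mem_support_iff_of_finite.mpr
        ((Module.annihilator_le_annihilator_tensorProduct B N M).trans hQ)) hpQ)
  obtain ⟨Q', hQ', hle⟩ := Ideal.exists_minimalPrimes_le hQY
  have hprime : Q'.IsPrime := hQ'.1.1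
  refine ⟨Q', hle, hprime, le_antisymm (fun a ha ↦ ?_) ?_, ?_⟩
  · by_contra hap
    have hreg : IsSMulRegular (A ⧸ p) a := by
      rw [isSMulRegular_iff_right_eq_zero_of_smul]
      intro x hx
      obtain ⟨x, rfl⟩ := Ideal.Quotient.mk_surjective x
      rw [Algebra.smul_def, Ideal.Quotient.algebraMap_eq, ← map_mul,
        Ideal.Quotient.eq_zero_iff_mem] at hx
      exact Ideal.Quotient.eq_zero_iff_mem.mpr ((‹p.IsPrime›.mem_or_mem hx).resolve_left hap)
    have hreg' : IsSMulRegular (N ⊗[A] (A ⧸ p)) (algebraMap A B a) := fun x y hxy ↦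
      hreg.lTensor N (by simpa only [algebraMap_smul] using hxy)
    have hmem : algebraMap A B a ∈
        ⋃ P ∈ associatedPrimes B (N ⊗[A] (A ⧸ p)), (P : Set B) :=
      Set.mem_biUnion
        (Module.associatedPrimes.minimalPrimes_annihilator_subset_associatedPrimes _ _ hQ') ha
    rw [biUnion_associatedPrimes_eq_compl_regular] at hmem
    exact hmem hreg'
  · have h := Module.annihilator_le_comap_annihilator_tensorProduct (A := A) B N (A ⧸ p)
    rw [Ideal.annihilator_quotient] at h
    exact h.trans (Ideal.comap_mono hQ'.1.2)
  · have hY : (⟨Q', hprime⟩ : PrimeSpectrum B) ∈ Module.support B (N ⊗[A] (A ⧸ p)) :=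
      Module.mem_support_iff_of_finite.mpr hQ'.1.2
    have hM : (⟨p, ‹_›⟩ : PrimeSpectrum A) ∈ Module.support A M :=
      Module.mem_support_iff_of_finite.mpr hp
    exact Module.mem_support_iff_of_finite.mp
      (Module.support_tensorProduct_quotient_subset hM hY)

end Support

/-! ### The dimension formula. -/

section Dimension

open IsLocalRing

theorem IsLocalRing.height_map_mk_maximalIdeal {R : Type*} [CommRing R] [IsLocalRing R]
    {K : Ideal R} (hK : K ≤ maximalIdeal R) :
    (((maximalIdeal R).map (Ideal.Quotient.mk K)).height : WithBot ℕ∞) = ringKrullDim (R ⧸ K) := by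
  have : Nontrivial (R ⧸ K) := Ideal.Quotient.nontrivial_iff.mpr
    (ne_top_of_le_ne_top (maximalIdeal.isMaximal R).ne_top hK)
  have : IsLocalRing (R ⧸ K) := .of_surjective' _ Ideal.Quotient.mk_surjective
  rw [← maximalIdeal_height_eq_ringKrullDim]
  congr 2
  refine IsLocalRing.eq_maximalIdeal ((Ideal.map_eq_top_or_isMaximal_of_surjective _
    Ideal.Quotient.mk_surjective (maximalIdeal.isMaximal R)).resolve_left fun h ↦ ?_)
  have := congrArg (Ideal.comap (Ideal.Quotient.mk K)) h
  rw [Ideal.comap_map_mk hK, Ideal.comap_top] at this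
  exact (maximalIdeal.isMaximal R).ne_top this

theorem Module.supportDim_quotient_smul_top {R : Type*} [CommRing R] (M : Type*)
    [AddCommGroup M] [Module R M] [Module.Finite R M] (I : Ideal R) :
    Module.supportDim R (M ⧸ (I • ⊤ : Submodule R M)) =
      ringKrullDim (R ⧸ Module.annihilator R M ⊔ I) := by
  rw [← Module.supportDim_quotient_eq_ringKrullDim, Module.supportDim, Module.supportDim,
    Module.support_quotient, Module.support_eq_zeroLocus, Module.support_eq_zeroLocus,
    Ideal.annihilator_quotient, PrimeSpectrum.zeroLocus_sup]

variable {A B : Type*} [CommRing A] [IsLocalRing A] [IsNoetherianRing A]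
  [CommRing B] [IsLocalRing B] [IsNoetherianRing B] [Algebra A B] [IsLocalHom (algebraMap A B)]

variable (B) in
/-- The dimension formula for a module that is flat over the base of a local homomorphism. -/
theorem Module.supportDim_tensorProduct (N : Type*) [AddCommGroup N] [Module A N] [Module B N]
    [IsScalarTower A B N] [Module.Finite B N] [Module.Flat A N]
    (M : Type*) [AddCommGroup M] [Module A M] [Module.Finite A M] [Nontrivial (N ⊗[A] M)] :
    Module.supportDim B (N ⊗[A] M) = Module.supportDim A M +
      Module.supportDim B ((N ⊗[A] M) ⧸
        ((maximalIdeal A).map (algebraMap A B) • ⊤ : Submodule B (N ⊗[A] M))) := by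
  have : Nontrivial M := by
    by_contra! h
    exact not_subsingleton (N ⊗[A] M) inferInstance
  rw [Module.supportDim_quotient_smul_top, Module.supportDim_eq_ringKrullDim_quotient_annihilator,
    Module.supportDim_eq_ringKrullDim_quotient_annihilator]
  set 𝔞 := Module.annihilator A M
  set 𝔟 := Module.annihilator B (N ⊗[A] M)
  have h𝔞𝔟 : 𝔞 ≤ 𝔟.comap (algebraMap A B) :=
    Module.annihilator_le_comap_annihilator_tensorProduct B N M
  have h𝔞 : 𝔞 ≠ ⊤ := by
    rw [Ne, Module.annihilator_eq_top_iff]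
    exact not_subsingleton M
  have h𝔟 : 𝔟 ≠ ⊤ := by
    rw [Ne, Module.annihilator_eq_top_iff]
    exact not_subsingleton _
  have : Nontrivial (A ⧸ 𝔞) := Ideal.Quotient.nontrivial_iff.mpr h𝔞
  have : Nontrivial (B ⧸ 𝔟) := Ideal.Quotient.nontrivial_iff.mpr h𝔟
  have : IsLocalRing (A ⧸ 𝔞) := .of_surjective' _ Ideal.Quotient.mk_surjective
  have : IsLocalRing (B ⧸ 𝔟) := .of_surjective' _ Ideal.Quotient.mk_surjective
  let f : (A ⧸ 𝔞) →+* (B ⧸ 𝔟) := Ideal.quotientMap 𝔟 (algebraMap A B) h𝔞𝔟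
  let : Algebra (A ⧸ 𝔞) (B ⧸ 𝔟) := f.toAlgebra
  have hf (a : A) : algebraMap (A ⧸ 𝔞) (B ⧸ 𝔟) (Ideal.Quotient.mk 𝔞 a) =
    Ideal.Quotient.mk 𝔟 (algebraMap A B a) := rfl
  -- Only `N` is flat over `A`, so going-down for flat algebras does not apply; it is obtained by
  -- lifting primes to `A` and `B`.
  have : Algebra.HasGoingDown (A ⧸ 𝔞) (B ⧸ 𝔟) := by
    refine ⟨fun {p} _ Q _ hlt ↦ ?_⟩
    have hp : 𝔞 ≤ p.comap (Ideal.Quotient.mk 𝔞) :=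
      Ideal.mk_ker.ge.trans (Ideal.ker_le_comap _)
    have hQ : 𝔟 ≤ Q.comap (Ideal.Quotient.mk 𝔟) :=
      Ideal.mk_ker.ge.trans (Ideal.ker_le_comap _)
    obtain ⟨Q', hle, hprime, hcomap, h𝔟Q'⟩ := Module.exists_le_comap_eq_of_flat hp hQ
      (fun a ha ↦ hlt.le ha)
    refine ⟨Q'.map (Ideal.Quotient.mk 𝔟), Ideal.map_le_iff_le_comap.mpr hle,
      Ideal.isPrime_map_quotientMk_of_isPrime h𝔟Q', ⟨?_⟩⟩
    ext x
    obtain ⟨a, rfl⟩ := Ideal.Quotient.mk_surjective x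
    rw [Ideal.under_def, Ideal.mem_comap, hf, ← Ideal.mem_comap,
      ← Ideal.mem_comap (f := Ideal.Quotient.mk 𝔟), Ideal.comap_map_mk h𝔟Q', ← hcomap,
      Ideal.mem_comap]
  have hmA : maximalIdeal (A ⧸ 𝔞) = (maximalIdeal A).map (Ideal.Quotient.mk 𝔞) := by
    refine (IsLocalRing.eq_maximalIdeal ((Ideal.map_eq_top_or_isMaximal_of_surjective _
      Ideal.Quotient.mk_surjective (maximalIdeal.isMaximal A)).resolve_left fun h ↦ ?_)).symm
    have := congrArg (Ideal.comap (Ideal.Quotient.mk 𝔞)) h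
    rw [Ideal.comap_map_mk (le_maximalIdeal h𝔞), Ideal.comap_top] at this
    exact (maximalIdeal.isMaximal A).ne_top this
  have hK : (maximalIdeal (A ⧸ 𝔞)).map (algebraMap (A ⧸ 𝔞) (B ⧸ 𝔟)) =
      ((maximalIdeal A).map (algebraMap A B)).map (Ideal.Quotient.mk 𝔟) := by
    rw [hmA, Ideal.map_map, Ideal.map_map]
    rfl
  have hlocal : IsLocalHom (algebraMap (A ⧸ 𝔞) (B ⧸ 𝔟)) := by
    refine ((local_hom_TFAE _).out 0 2).mpr ?_
    rw [hK, Ideal.map_le_iff_le_comap]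
    refine (map_algebraMap_le_maximalIdeal le_rfl).trans (IsLocalRing.eq_maximalIdeal
      (Ideal.comap_isMaximal_of_surjective _ Ideal.Quotient.mk_surjective)).ge
  have : (maximalIdeal (B ⧸ 𝔟)).LiesOver (maximalIdeal (A ⧸ 𝔞)) :=
    ⟨Eq.symm (((local_hom_TFAE (algebraMap (A ⧸ 𝔞) (B ⧸ 𝔟))).out 0 4).mp hlocal)⟩
  -- The last term of this height formula is the dimension of `B/(𝔟 + 𝔪_A B)`, that is, of the
  -- support of the fibre.
  have key := Ideal.height_eq_height_add_of_liesOver_of_hasGoingDown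
    (maximalIdeal (A ⧸ 𝔞)) (maximalIdeal (B ⧸ 𝔟))
  rw [← maximalIdeal_height_eq_ringKrullDim, ← maximalIdeal_height_eq_ringKrullDim, key,
    WithBot.coe_add, height_map_mk_maximalIdeal (map_algebraMap_le_maximalIdeal le_rfl), hK,
    ringKrullDim_eq_of_ringEquiv (DoubleQuot.quotQuotEquivQuotSup _ _)]

end Dimension

/-! ### Invariance of grade and dimension under linear equivalences. -/

section Transport

variable {R : Type*} [CommRing R] {M M' : Type*} [AddCommGroup M] [Module R M]
  [AddCommGroup M'] [Module R M']

theorem LinearEquiv.map_ideal_smul_top (e : M ≃ₗ[R] M') (I : Ideal R) :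
    (I • ⊤ : Submodule R M).map (e : M →ₗ[R] M') = I • ⊤ := by
  rw [Submodule.map_smul'', Submodule.map_top, LinearEquiv.range]

theorem LinearEquiv.gradeOn_eq (e : M ≃ₗ[R] M') (I : Ideal R) : I.gradeOn M = I.gradeOn M' := by
  have h : (I • ⊤ : Submodule R M) = ⊤ ↔ (I • ⊤ : Submodule R M') = ⊤ := by
    rw [← e.map_ideal_smul_top, Submodule.map_eq_top_iff]
  simp only [Ideal.gradeOn, h, e.isRegular_congr]

theorem LinearEquiv.supportDim_quotient_smul_top_eq (e : M ≃ₗ[R] M') (I : Ideal R) :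
    Module.supportDim R (M ⧸ (I • ⊤ : Submodule R M)) =
      Module.supportDim R (M' ⧸ (I • ⊤ : Submodule R M')) :=
  Module.supportDim_eq_of_equiv (Submodule.Quotient.equiv _ _ e (e.map_ideal_smul_top I))

end Transport

/-! ### Localizing the tensor product at `q` and `p`. -/

section Localization

variable {R S : Type*} [CommRing R] [CommRing S] [Algebra R S]

/-- `(B ⊗[S] N) ⊗[R] P` is `B ⊗[S] (N ⊗[R] P)`, a composite of two functors that preserve
injections; `N` need not be flat over `S`. -/
theorem Module.Flat.tensorProduct_of_isScalarTower (B : Type*) [CommRing B] [Algebra S B]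
    [Algebra R B] [IsScalarTower R S B] [Module.Flat S B]
    (N : Type*) [AddCommGroup N] [Module R N] [Module S N] [IsScalarTower R S N]
    [Module.Flat R N] : Module.Flat R (B ⊗[S] N) := by
  rw [Module.Flat.iff_lTensor_preserves_injective_linearMap]
  intro P P' _ _ _ _ φ hφ
  have h : Function.Injective ((TensorProduct.AlgebraTensorModule.lTensor S N φ).lTensor B) :=
    Module.Flat.lTensor_preserves_injective_linearMap _
      (Module.Flat.lTensor_preserves_injective_linearMap φ hφ)
  let e := TensorProduct.AlgebraTensorModule.assoc R S B B N P
  let e' := TensorProduct.AlgebraTensorModule.assoc R S B B N P'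
  have hcomm : ∀ x, e' (φ.lTensor (B ⊗[S] N) x) =
      (TensorProduct.AlgebraTensorModule.lTensor S N φ).lTensor B (e x) := by
    intro x
    induction x with
    | zero => simp
    | add x y hx hy => simp only [map_add, hx, hy]
    | tmul t y =>
      induction t with
      | zero => simp
      | add x y hx hy => simp only [TensorProduct.add_tmul, map_add, hx, hy]
      | tmul b n => rfl
  intro x y hxy
  exact e.injective (h (by rw [← hcomm, ← hcomm, hxy]))

/-- For `q` lying over `p`, the localization of `N ⊗ M` at `q` is the tensor product over `R_p`
of the localizations of `N` at `q` and of `M` at `p`. -/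
noncomputable def LocalizedModule.AtPrime.tensorProductEquiv (q : Ideal S) [q.IsPrime]
    (p : Ideal R) [p.IsPrime]
    [Algebra (Localization.AtPrime p) (Localization.AtPrime q)]
    [IsScalarTower R (Localization.AtPrime p) (Localization.AtPrime q)]
    (N : Type*) [AddCommGroup N] [Module R N] [Module S N] [IsScalarTower R S N]
    (M : Type*) [AddCommGroup M] [Module R M] :
    LocalizedModule.AtPrime q (N ⊗[R] M) ≃ₗ[Localization.AtPrime q]
      (Localization.AtPrime q ⊗[S] N) ⊗[Localization.AtPrime p] LocalizedModule.AtPrime p M :=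
  LocalizedModule.equivTensorProduct q.primeCompl (N ⊗[R] M) ≪≫ₗ
    (TensorProduct.AlgebraTensorModule.assoc R S (Localization.AtPrime q)
      (Localization.AtPrime q) N M).symm ≪≫ₗ
    (TensorProduct.AlgebraTensorModule.cancelBaseChange R (Localization.AtPrime p)
      (Localization.AtPrime q) (Localization.AtPrime q ⊗[S] N) M).symm ≪≫ₗ
    TensorProduct.AlgebraTensorModule.congr (.refl _ _)
      (LocalizedModule.equivTensorProduct p.primeCompl M).symm

end Localization

/-! ### The equivalence over local rings, and the theorem. -/

section CohenMacaulay

open IsLocalRing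

theorem IsLocalRing.exists_supportDim_eq_natCast {R : Type*} [CommRing R] [IsLocalRing R]
    [IsNoetherianRing R] (M : Type*) [AddCommGroup M] [Module R M] [Nontrivial M] :
    ∃ n : ℕ, Module.supportDim R M = n := by
  have h1 : Module.supportDim R M ≠ ⊥ := Module.supportDim_ne_bot_of_nontrivial R M
  have h2 : Module.supportDim R M ≠ ⊤ :=
    ((Module.supportDim_le_ringKrullDim R M).trans_lt ringKrullDim_lt_top).ne
  obtain ⟨m, hm⟩ := WithBot.ne_bot_iff_exists.mp h1
  have hm' : m ≠ ⊤ := by rintro rfl; exact h2 hm.symm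
  obtain ⟨n, rfl⟩ := ENat.ne_top_iff_exists.mp hm'
  exact ⟨n, hm.symm⟩

theorem Ideal.isCohenMacaulayOn_tensorProduct_tfae {A B : Type*}
    [CommRing A] [IsLocalRing A] [IsNoetherianRing A] [CommRing B] [IsLocalRing B]
    [IsNoetherianRing B] [Algebra A B] [IsLocalHom (algebraMap A B)]
    {N : Type*} [AddCommGroup N] [Module A N] [Module B N]
    [IsScalarTower A B N] [Module.Finite B N] [Module.Flat A N]
    {M : Type*} [AddCommGroup M] [Module A M] [Module.Finite A M] [Nontrivial (N ⊗[A] M)]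
    {J : Ideal A} (hJ : J ≤ maximalIdeal A) :
    List.TFAE [
      J.IsCohenMacaulayOn M ∧
        Module.supportDim B ((N ⊗[A] M) ⧸
          ((maximalIdeal A).map (algebraMap A B) • ⊤ : Submodule B (N ⊗[A] M))) = 0,
      (J.map (algebraMap A B)).IsCohenMacaulayOn (N ⊗[A] M) ∧
        J.gradeOn M = (J.map (algebraMap A B)).gradeOn (N ⊗[A] M) ∧
        Module.supportDim A (M ⧸ (J • ⊤ : Submodule A M)) =
          Module.supportDim B ((N ⊗[A] M) ⧸
            (J.map (algebraMap A B) • ⊤ : Submodule B (N ⊗[A] M))),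
      (J.map (algebraMap A B)).IsCohenMacaulayOn (N ⊗[A] M) ∧
        J.gradeOn M = (J.map (algebraMap A B)).gradeOn (N ⊗[A] M) ∧
        Module.supportDim A M = Module.supportDim B (N ⊗[A] M)] := by
  have hM : Nontrivial M := by
    by_contra! h
    exact not_subsingleton (N ⊗[A] M) inferInstance
  have hJB := map_algebraMap_le_maximalIdeal (B := B) hJ
  have hMJ : Nontrivial (M ⧸ (J • ⊤ : Submodule A M)) :=
    Submodule.Quotient.nontrivial_iff.mpr (ideal_smul_top_lt_top hJ).ne
  have hXJ : Nontrivial ((N ⊗[A] M) ⧸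
      (J.map (algebraMap A B) • ⊤ : Submodule B (N ⊗[A] M))) :=
    Submodule.Quotient.nontrivial_iff.mpr (ideal_smul_top_lt_top hJB).ne
  have hXm : Nontrivial ((N ⊗[A] M) ⧸
      ((maximalIdeal A).map (algebraMap A B) • ⊤ : Submodule B (N ⊗[A] M))) :=
    Submodule.Quotient.nontrivial_iff.mpr
      (ideal_smul_top_lt_top (map_algebraMap_le_maximalIdeal le_rfl)).ne
  let e := TensorProduct.AlgebraTensorModule.tensorQuotSMulTopEquiv (B := B) N M J
  have : Nontrivial (N ⊗[A] (M ⧸ (J • ⊤ : Submodule A M))) := e.toEquiv.nontrivial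
  have hfiber : Module.supportDim B (N ⊗[A] (M ⧸ (J • ⊤ : Submodule A M)) ⧸
        ((maximalIdeal A).map (algebraMap A B) • ⊤ :
          Submodule B (N ⊗[A] (M ⧸ (J • ⊤ : Submodule A M))))) =
      Module.supportDim B ((N ⊗[A] M) ⧸
        ((maximalIdeal A).map (algebraMap A B) • ⊤ : Submodule B (N ⊗[A] M))) := by
    -- Both supports are `Supp X ∩ V(𝔪_A B)`, because `V(𝔪_A B) ⊆ V(JB)`.
    simp only [Module.supportDim]
    rw [Module.support_quotient, Module.support_quotient, e.support_eq, Module.support_quotient,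
      Set.inter_assoc, Set.inter_eq_right.mpr
        (PrimeSpectrum.zeroLocus_anti_mono (Ideal.map_mono hJ))]
  have hdimX := Module.supportDim_tensorProduct (A := A) B N M
  have hdimXJ := Module.supportDim_tensorProduct (A := A) B N (M ⧸ (J • ⊤ : Submodule A M))
  rw [hfiber, Module.supportDim_eq_of_equiv e] at hdimXJ
  have hgrade := Ideal.gradeOn_tensorProduct B N M hJ
  simp only [Ideal.IsCohenMacaulayOn, hgrade, hdimX, hdimXJ, true_and]
  obtain ⟨d, hd⟩ := exists_supportDim_eq_natCast (R := A) M
  obtain ⟨c, hc⟩ := exists_supportDim_eq_natCast (R := A) (M ⧸ (J • ⊤ : Submodule A M))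
  obtain ⟨f, hf⟩ := exists_supportDim_eq_natCast (R := B) ((N ⊗[A] M) ⧸
      ((maximalIdeal A).map (algebraMap A B) • ⊤ : Submodule B (N ⊗[A] M)))
  rw [hd, hc, hf]
  -- The finiteness of `g` is not needed: `c`, `d` and `f` are natural numbers, and `g` is never
  -- cancelled.
  generalize J.gradeOn M = g
  have hcast (a b : ℕ) : (a : WithBot ℕ∞) = b ↔ a = b := by norm_cast
  have hg (a b : ℕ) : (g : WithBot ℕ∞) + a = b ↔ g + a = b := by norm_cast
  have hf0 : (f : WithBot ℕ∞) = 0 ↔ f = 0 := by norm_cast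
  rw [← Nat.cast_add, ← Nat.cast_add, hcast, hcast, hg, hg, hf0]
  have hcancel : f = 0 → (g + (c : ℕ∞) = d ↔ g + ((c + f : ℕ) : ℕ∞) = ((d + f : ℕ) : ℕ∞)) := by
    rintro rfl; simp
  tfae_have 1 ↔ 2 := ⟨fun h ↦ ⟨(hcancel h.2).mp h.1, by lia⟩,
    fun h ↦ ⟨(hcancel (by lia)).mpr h.1, by lia⟩⟩
  tfae_have 1 ↔ 3 := ⟨fun h ↦ ⟨(hcancel h.2).mp h.1, by lia⟩,
    fun h ↦ ⟨(hcancel (by lia)).mpr h.1, by lia⟩⟩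
  tfae_finish

end CohenMacaulay

/-- Here `p = q ∩ R`. The tensor product `M ⊗ N` is written `N ⊗[R] M`, because Mathlib lets `S` act
on a tensor product through its left factor. -/
theorem corollary8 {R S M N : Type*} [CommRing R] [IsNoetherianRing R]
    [CommRing S] [IsNoetherianRing S] [Algebra R S]
    [AddCommGroup M] [Module R M] [Module.Finite R M]
    [AddCommGroup N] [Module R N] [Module S N] [IsScalarTower R S N]
    [Module.Finite S N] [Module.Flat R N]
    (I : Ideal R) (q : Ideal S) [q.IsPrime] (p : Ideal R) [p.IsPrime]
    (hp : p = q.comap (algebraMap R S)) (hIp : I ≤ p)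
    (hne : (⊤ : Submodule (Localization.AtPrime q) (LocalizedModule.AtPrime q (N ⊗[R] M))) ≠
      Ideal.extendAtPrime q I • ⊤) :
    List.TFAE [
      -- (1)
      (I.map (algebraMap R (Localization.AtPrime p))).IsCohenMacaulayOn
          (LocalizedModule.AtPrime p M) ∧
        Module.supportDim (Localization.AtPrime q)
          (LocalizedModule.AtPrime q (N ⊗[R] M) ⧸
            (Ideal.extendAtPrime q p • ⊤ : Submodule (Localization.AtPrime q)
              (LocalizedModule.AtPrime q (N ⊗[R] M)))) = 0,
      -- (2)
      (Ideal.extendAtPrime q I).IsCohenMacaulayOn (LocalizedModule.AtPrime q (N ⊗[R] M)) ∧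
        (I.map (algebraMap R (Localization.AtPrime p))).gradeOn (LocalizedModule.AtPrime p M) =
          (Ideal.extendAtPrime q I).gradeOn (LocalizedModule.AtPrime q (N ⊗[R] M)) ∧
        Module.supportDim (Localization.AtPrime p)
          (LocalizedModule.AtPrime p M ⧸
            (I.map (algebraMap R (Localization.AtPrime p)) • ⊤ :
              Submodule (Localization.AtPrime p) (LocalizedModule.AtPrime p M))) =
          Module.supportDim (Localization.AtPrime q)
            (LocalizedModule.AtPrime q (N ⊗[R] M) ⧸
              (Ideal.extendAtPrime q I • ⊤ : Submodule (Localization.AtPrime q)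
                (LocalizedModule.AtPrime q (N ⊗[R] M)))),
      -- (3)
      (Ideal.extendAtPrime q I).IsCohenMacaulayOn (LocalizedModule.AtPrime q (N ⊗[R] M)) ∧
        (I.map (algebraMap R (Localization.AtPrime p))).gradeOn (LocalizedModule.AtPrime p M) =
          (Ideal.extendAtPrime q I).gradeOn (LocalizedModule.AtPrime q (N ⊗[R] M)) ∧
        Module.supportDim (Localization.AtPrime p) (LocalizedModule.AtPrime p M) =
          Module.supportDim (Localization.AtPrime q)
            (LocalizedModule.AtPrime q (N ⊗[R] M))] := by
  have : q.LiesOver p := ⟨hp⟩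
  let A := Localization.AtPrime p
  let B := Localization.AtPrime q
  let : Algebra A B := Localization.AtPrime.algebraOfLiesOver p q
  have hAB : algebraMap A B = Localization.localRingHom p q (algebraMap R S) hp := rfl
  have : IsLocalHom (algebraMap A B) := by rw [hAB]; infer_instance
  have : Module.Flat R (B ⊗[S] N) := Module.Flat.tensorProduct_of_isScalarTower B N
  -- For a module over the localization `A`, flatness over `R` and flatness over `A` agree.
  have : Module.Flat A (B ⊗[S] N) :=
    (Module.flat_iff_of_isLocalization A p.primeCompl (B ⊗[S] N)).mpr inferInstance
  have hext (K : Ideal R) : Ideal.extendAtPrime q K =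
      (K.map (algebraMap R A)).map (algebraMap A B) := by
    rw [Ideal.extendAtPrime, Ideal.map_map, Ideal.map_map, ← IsScalarTower.algebraMap_eq,
      ← IsScalarTower.algebraMap_eq]
  have hJ : I.map (algebraMap R A) ≤ IsLocalRing.maximalIdeal A :=
    (Ideal.map_mono hIp).trans_eq (Localization.AtPrime.map_eq_maximalIdeal (I := p))
  let e := LocalizedModule.AtPrime.tensorProductEquiv q p N M
  have hnontriv : Nontrivial (LocalizedModule.AtPrime q (N ⊗[R] M)) := by
    by_contra! h
    exact hne (Subsingleton.elim _ _)
  have : Nontrivial ((B ⊗[S] N) ⊗[A] LocalizedModule.AtPrime p M) := e.symm.toEquiv.nontrivial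
  have key := Ideal.isCohenMacaulayOn_tensorProduct_tfae (A := A) (B := B) (N := B ⊗[S] N)
    (M := LocalizedModule.AtPrime p M) hJ
  rw [hext I, hext p, Localization.AtPrime.map_eq_maximalIdeal (I := p)]
  have hgrade := LinearEquiv.gradeOn_eq (R := B) (M := LocalizedModule.AtPrime q (N ⊗[R] M))
    (M' := (B ⊗[S] N) ⊗[A] LocalizedModule.AtPrime p M) e
  have hquot := LinearEquiv.supportDim_quotient_smul_top_eq (R := B)
    (M := LocalizedModule.AtPrime q (N ⊗[R] M))
    (M' := (B ⊗[S] N) ⊗[A] LocalizedModule.AtPrime p M) e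
  have hdim := Module.supportDim_eq_of_equiv (R := B)
    (M := LocalizedModule.AtPrime q (N ⊗[R] M))
    (N := (B ⊗[S] N) ⊗[A] LocalizedModule.AtPrime p M) e
  simp only [Ideal.IsCohenMacaulayOn, ← hgrade, ← hquot, ← hdim] at key
  exact key
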